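/- Let $Y$ be a real Banach space with closed unit ball $B_Y$ and unit sphere $S_{Y^*}$ of its dual. A *slice* of $B_Y$ is a set $S(y^*,\varepsilon)=\{y\in B_Y : y^*(y)>1-\varepsilon\}$ with $y^*\in S_{Y^*}$ and $\varepsilon>0$; a *finite convex combination of slices* is a set $\sum_{i=1}^n\lambda_i S(y_i^*,\varepsilon_i)$ (Minkowski sum) with $\lambda_i\ge 0$, $\sum_{i=1}^n\lambda_i=1$, $y_i^*\in S_{Y^*}$, $\varepsilon_i>0$. The space $Y$ has - the *local diameter 2 property* (LD2P) if every slice of $B_Y$ has diameter $2$; - the *diameter 2 property* (D2P) if every non-empty relatively weakly open subset of $B_Y$ has diameter $2$; - the *strong diameter 2 property* (SD2P) if every finite convex combination of slices of $B_Y$ has diameter $2$. A closed subspace $X$ of $Y$ is an *almost isometric ideal* (ai-ideal) in $Y$ if for every $\varepsilon>0$ and every finite-dimensional subspace $E$ of $Y$ there is a linear operator $T:E\to X$ such that $Te=e$ for all $e\in E\cap X$ and $(1-\varepsilon)\|e\|\le\|Te\|\le(1+\varepsilon)\|e\|$ for all $e\in E$. **Proposition.** The Banach space $Y$ has the SD2P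 if and only if every separable ai-ideal in $Y$ has the SD2P. Likewise, $Y$ has the D2P if and only if every separable ai-ideal in $Y$ has the D2P, and $Y$ has the LD2P if and only if every separable ai-ideal in $Y$ has the LD2P. -/

import Mathlib

namespace DiamTwo

section

variable {Y : Type*} [NormedAddCommGroup Y] [NormedSpace ℝ Y]

/-- The set `{y ∈ B_Y : f y > 1 - ε}`; it is a slice of the closed unit ball `B_Y` when
`‖f‖ = 1` and `0 < ε`. -/
def slice (f : StrongDual ℝ Y) (ε : ℝ) : Set Y :=
  {y | y ∈ Metric.closedBall (0 : Y) 1 ∧ 1 - ε < f y}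

/-- The Minkowski combination `∑ i, c i • S(f i, ε i)`. -/
def sliceCombination {n : ℕ} (c : Fin n → ℝ) (f : Fin n → StrongDual ℝ Y) (ε : Fin n → ℝ) :
    Set Y :=
  {y | ∃ z : Fin n → Y, (∀ i, z i ∈ slice (f i) (ε i)) ∧ y = ∑ i, c i • z i}

/-- `V` is a relatively weakly open subset of the closed unit ball. -/
def IsRelWeaklyOpen (V : Set Y) : Prop :=
  ∃ U : Set (WeakSpace ℝ Y), IsOpen U ∧
    V = Metric.closedBall (0 : Y) 1 ∩ toWeakSpace ℝ Y ⁻¹' U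

/-- `X` is an almost isometric ideal in `Y`. -/
def IsAIIdeal (X : Submodule ℝ Y) : Prop :=
  ∀ ε : ℝ, 0 < ε → ∀ E : Submodule ℝ Y, FiniteDimensional ℝ E →
    ∃ T : E →ₗ[ℝ] X,
      (∀ e : E, (e : Y) ∈ X → (T e : Y) = (e : Y)) ∧
      (∀ e : E, (1 - ε) * ‖e‖ ≤ ‖T e‖ ∧ ‖T e‖ ≤ (1 + ε) * ‖e‖)

end

section

variable (Y : Type*) [NormedAddCommGroup Y] [NormedSpace ℝ Y]

/-- Local diameter 2 property: every slice of the unit ball has diameter 2. -/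
def LD2P : Prop :=
  ∀ (f : StrongDual ℝ Y) (ε : ℝ), ‖f‖ = 1 → 0 < ε → Metric.diam (slice f ε) = 2

/-- Diameter 2 property: every nonempty relatively weakly open subset of the unit ball has
diameter 2. -/
def D2P : Prop :=
  ∀ V : Set Y, IsRelWeaklyOpen V → V.Nonempty → Metric.diam V = 2

/-- Strong diameter 2 property: every finite convex combination of slices of the unit ball has
diameter 2. -/
def SD2P : Prop :=
  ∀ (n : ℕ) (c : Fin n → ℝ) (f : Fin n → StrongDual ℝ Y) (ε : Fin n → ℝ),
    (∀ i, 0 ≤ c i) → ∑ i, c i = 1 → (∀ i, ‖f i‖ = 1) → (∀ i, 0 < ε i) →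
    Metric.diam (sliceCombination c f ε) = 2

end

end DiamTwo

/-!
If `X` is an almost isometric ideal, rescaled extensions of the local operators `E → X` form a net
of linear maps `R i : Y → X` that are asymptotically contractive, isometric, and the identity on
`X`. The limit of `f ∘ R i` along an ultrafilter extends a functional `f` on `X` to `Y` without
increasing its norm, so the slices and weakly open sets of `B_X` come from those of `B_Y`, and
`R i` carries two points of the latter at distance almost `2` to two such points of the former.

Conversely, a slice, a convex combination of slices or a nonempty weakly open set of `B_Y` meets
the ball of any subspace containing suitable countably many vectors in a set of the same kind. It
remains to see that a countable set lies in a separable almost isometric ideal. For a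
finite-dimensional `F`, the norm of `f + ∑ j, a j • y j` as a function of `(f, a)` in the unit
ball of `F × ℝᵏ` ranges over a subset of a separable space of continuous functions, so countably
many tuples `y` approximate all of them; closing up under these choices for the spans `F` of all
finite subsets gives the ideal.
-/

namespace DiamTwo

open Filter Topology

section Diameter

theorem diam_eq_two_iff_of_subset_closedBall {E : Type*} [SeminormedAddCommGroup E] {A : Set E}
    (hA : A ⊆ Metric.closedBall 0 1) :
    Metric.diam A = 2 ↔ ∀ r < (2 : ℝ), ∃ a ∈ A, ∃ b ∈ A, r < ‖a - b‖ := by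
  have diam_le : Metric.diam A ≤ 2 := by
    simpa using (Metric.diam_mono hA Metric.isBounded_closedBall).trans
      (Metric.diam_closedBall zero_le_one)
  constructor
  · intro hdiam r hr
    by_contra! hdist
    have : Metric.diam A ≤ max r 0 :=
      Metric.diam_le_of_forall_dist_le (le_max_right _ _) fun a ha b hb => by
        rw [dist_eq_norm]
        exact (hdist a ha b hb).trans (le_max_left _ _)
    exact (max_lt hr two_pos).not_ge (hdiam ▸ this)
  · intro h
    refine diam_le.antisymm (le_of_forall_lt fun r hr => ?_)
    obtain ⟨a, ha, b, hb, hab⟩ := h r hr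
    rw [← dist_eq_norm] at hab
    exact hab.trans_le (Metric.dist_le_diam_of_mem (Metric.isBounded_closedBall.subset hA) ha hb)

variable {Y : Type*} [NormedAddCommGroup Y] [NormedSpace ℝ Y] {X : Submodule ℝ Y}

theorem slice_subset_closedBall (f : StrongDual ℝ Y) (ε : ℝ) :
    slice f ε ⊆ Metric.closedBall 0 1 := fun _ h => h.1

theorem sliceCombination_subset_closedBall {n : ℕ} {c : Fin n → ℝ} (f : Fin n → StrongDual ℝ Y)
    (ε : Fin n → ℝ) (hc : ∀ i, 0 ≤ c i) (hsum : ∑ i, c i = 1) :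
    sliceCombination c f ε ⊆ Metric.closedBall 0 1 := by
  rintro _ ⟨z, hz, rfl⟩
  exact (convex_closedBall (0 : Y) 1).sum_mem (fun i _ => hc i) hsum fun i _ => (hz i).1

theorem IsRelWeaklyOpen.subset_closedBall {V : Set Y} (hV : IsRelWeaklyOpen V) :
    V ⊆ Metric.closedBall 0 1 := by
  obtain ⟨U, -, rfl⟩ := hV
  exact Set.inter_subset_left

theorem coe_mem_closedBall_iff {x : X} {r : ℝ} :
    (x : Y) ∈ Metric.closedBall 0 r ↔ x ∈ Metric.closedBall 0 r := by
  simp only [mem_closedBall_zero_iff, Submodule.coe_norm]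

theorem coe_mem_slice_iff {f : StrongDual ℝ Y} {ε : ℝ} {x : X} :
    (x : Y) ∈ slice f ε ↔ x ∈ slice (f.comp X.subtypeL) ε :=
  and_congr_left' coe_mem_closedBall_iff

theorem coe_mem_sliceCombination {n : ℕ} {c : Fin n → ℝ} {f : Fin n → StrongDual ℝ Y}
    {ε : Fin n → ℝ} {x : X} (hx : x ∈ sliceCombination c (fun i => (f i).comp X.subtypeL) ε) :
    (x : Y) ∈ sliceCombination c f ε := by
  obtain ⟨z, hz, rfl⟩ := hx
  exact ⟨fun i => z i, fun i => coe_mem_slice_iff.2 (hz i), by simp⟩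

theorem IsRelWeaklyOpen.preimage_coe {V : Set Y} (hV : IsRelWeaklyOpen V) :
    IsRelWeaklyOpen ((↑) ⁻¹' V : Set X) := by
  obtain ⟨U, hU, rfl⟩ := hV
  refine ⟨WeakSpace.map X.subtypeL ⁻¹' U, hU.preimage (WeakSpace.map X.subtypeL).continuous, ?_⟩
  exact Set.ext fun x => and_congr_left' coe_mem_closedBall_iff

theorem diam_eq_two_of_coe_mem {A : Set Y} {B : Set X} (hA : A ⊆ Metric.closedBall 0 1)
    (hBA : ∀ x ∈ B, (x : Y) ∈ A) (hB : Metric.diam B = 2) : Metric.diam A = 2 := by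
  have hBball : B ⊆ Metric.closedBall 0 1 := fun x hx => coe_mem_closedBall_iff.1 (hA (hBA x hx))
  rw [diam_eq_two_iff_of_subset_closedBall hBball] at hB
  refine (diam_eq_two_iff_of_subset_closedBall hA).2 fun r hr => ?_
  obtain ⟨a, ha, b, hb, hab⟩ := hB r hr
  exact ⟨a, hBA a ha, b, hBA b hb, hab⟩

end Diameter

section AsymptoticRetraction

variable {Y : Type*} [NormedAddCommGroup Y] [NormedSpace ℝ Y] {X : Submodule ℝ Y}

theorem isAIIdeal_iff_exists_linearMap : IsAIIdeal X ↔
    ∀ ε : ℝ, 0 < ε → ∀ E : Submodule ℝ Y, FiniteDimensional ℝ E →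
      ∃ T : Y →ₗ[ℝ] X, (∀ x : X, (x : Y) ∈ E → T x = x) ∧
        ∀ y ∈ E, |‖T y‖ - ‖y‖| ≤ ε * ‖y‖ := by
  refine forall₄_congr fun ε _ E _ => ⟨?_, ?_⟩
  · rintro ⟨T, hfix, hnorm⟩
    obtain ⟨T', hT'⟩ := T.exists_extend
    have extends_T (e : E) : T' e = T e := LinearMap.congr_fun hT' e
    refine ⟨T', fun x hx => ?_, fun y hy => ?_⟩
    · exact (extends_T ⟨x, hx⟩).trans (Subtype.ext (hfix ⟨x, hx⟩ x.2))
    · obtain ⟨hlower, hupper⟩ := hnorm ⟨y, hy⟩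
      rw [extends_T ⟨y, hy⟩, abs_le]
      simp only [Submodule.coe_norm] at hlower hupper ⊢
      constructor <;> linarith
  · rintro ⟨T, hfix, hnorm⟩
    refine ⟨T ∘ₗ E.subtype, fun e he => congrArg Subtype.val (hfix ⟨e, he⟩ e.2), fun e => ?_⟩
    have := abs_le.1 (hnorm e e.2)
    simp only [LinearMap.comp_apply, Submodule.subtype_apply, Submodule.coe_norm] at this ⊢
    constructor <;> linarith

/-- A net of linear maps `R i : Y → X`, indexed along the filter `l`, that is asymptotically
contractive and isometric at each point of `Y` and converges pointwise to the identity on `X`. The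
maps are not required to be bounded; contractivity at `y` holds only eventually. -/
structure IsAsymptoticRetraction {ι : Type*} (l : Filter ι) (R : ι → Y →ₗ[ℝ] X) : Prop where
  eventually_norm_le : ∀ y, ∀ᶠ i in l, ‖R i y‖ ≤ ‖y‖
  tendsto_norm : ∀ y, Tendsto (fun i => ‖R i y‖) l (𝓝 ‖y‖)
  tendsto_coe : ∀ x : X, Tendsto (fun i => R i x) l (𝓝 x)

theorem IsAIIdeal.exists_isAsymptoticRetraction (hX : IsAIIdeal X) :
    ∃ R : Finset Y × ℕ → Y →ₗ[ℝ] X, IsAsymptoticRetraction atTop R := by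
  classical
  let δ (i : Finset Y × ℕ) : ℝ := 1 / ((i.2 : ℝ) + 1)
  have δ_pos (i) : 0 < δ i := Nat.one_div_pos_of_nat
  have δ_tendsto : Tendsto δ atTop (𝓝 0) := by
    rw [← prod_atTop_atTop_eq]
    exact tendsto_one_div_add_atTop_nhds_zero_nat.comp tendsto_snd
  have scale_tendsto : Tendsto (fun i => (1 + δ i)⁻¹) atTop (𝓝 1) := by
    simpa using (δ_tendsto.const_add 1).inv₀ (by norm_num)
  have eventually_mem_span (y : Y) : ∀ᶠ i : Finset Y × ℕ in atTop,
      y ∈ Submodule.span ℝ (i.1 : Set Y) := by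
    filter_upwards [eventually_ge_atTop (({y} : Finset Y), 0)] with i hi
    exact Submodule.subset_span (hi.1 (Finset.mem_singleton_self y))
  choose T hfix hnorm using fun i : Finset Y × ℕ =>
    isAIIdeal_iff_exists_linearMap.1 hX (δ i) (δ_pos i) (Submodule.span ℝ (i.1 : Set Y))
      (FiniteDimensional.span_finset ℝ i.1)
  have norm_T_tendsto (y : Y) : Tendsto (fun i => ‖T i y‖) atTop (𝓝 ‖y‖) := by
    rw [tendsto_iff_norm_sub_tendsto_zero]
    refine squeeze_zero' (Eventually.of_forall fun _ => norm_nonneg _) ?_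
      (by simpa only [zero_mul] using δ_tendsto.mul_const ‖y‖)
    filter_upwards [eventually_mem_span y] with i hy using hnorm i y hy
  have norm_scale (i) (y : Y) : ‖(1 + δ i)⁻¹ • T i y‖ = (1 + δ i)⁻¹ * ‖T i y‖ := by
    have := δ_pos i
    rw [norm_smul, Real.norm_of_nonneg (by positivity)]
  refine ⟨fun i => (1 + δ i)⁻¹ • T i, fun y => ?_, fun y => ?_, fun x => ?_⟩
  · filter_upwards [eventually_mem_span y] with i hy
    have := δ_pos i
    rw [LinearMap.smul_apply, norm_scale, inv_mul_le_iff₀ (by positivity)]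
    linarith [(abs_le.1 (hnorm i y hy)).2]
  · simpa only [LinearMap.smul_apply, norm_scale, one_mul] using
      scale_tendsto.mul (norm_T_tendsto y)
  · have : Tendsto (fun i => (1 + δ i)⁻¹ • x) atTop (𝓝 x) := by
      simpa only [one_smul] using scale_tendsto.smul_const x
    refine this.congr' ?_
    filter_upwards [eventually_mem_span x] with i hx
    rw [LinearMap.smul_apply, hfix i x hx]

namespace IsAsymptoticRetraction

variable {ι : Type*} {R : ι → Y →ₗ[ℝ] X}

theorem mono {l l' : Filter ι} (hR : IsAsymptoticRetraction l R) (h : l' ≤ l) :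
    IsAsymptoticRetraction l' R where
  eventually_norm_le y := h (hR.eventually_norm_le y)
  tendsto_norm y := (hR.tendsto_norm y).mono_left h
  tendsto_coe x := (hR.tendsto_coe x).mono_left h

theorem eventually_mem_closedBall {l : Filter ι} (hR : IsAsymptoticRetraction l R) {y : Y} {r : ℝ}
    (hy : y ∈ Metric.closedBall 0 r) : ∀ᶠ i in l, R i y ∈ Metric.closedBall 0 r := by
  filter_upwards [hR.eventually_norm_le y] with i hi
  exact mem_closedBall_zero_iff.2 (hi.trans (mem_closedBall_zero_iff.1 hy))

theorem eventually_mem_slice {l : Filter ι} (hR : IsAsymptoticRetraction l R)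
    {f : StrongDual ℝ X} {g : StrongDual ℝ Y} {ε : ℝ} {y : Y}
    (hfg : Tendsto (fun i => f (R i y)) l (𝓝 (g y))) (hy : y ∈ slice g ε) :
    ∀ᶠ i in l, R i y ∈ slice f ε :=
  (hR.eventually_mem_closedBall hy.1).and (hfg.eventually_const_lt hy.2)

theorem diam_eq_two {l : Filter ι} [l.NeBot] (hR : IsAsymptoticRetraction l R) {A : Set Y}
    {B : Set X} (hA : A ⊆ Metric.closedBall 0 1) (hB : B ⊆ Metric.closedBall 0 1)
    (hAB : ∀ y ∈ A, ∀ᶠ i in l, R i y ∈ B) (hdiam : Metric.diam A = 2) : Metric.diam B = 2 := by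
  rw [diam_eq_two_iff_of_subset_closedBall hA] at hdiam
  refine (diam_eq_two_iff_of_subset_closedBall hB).2 fun r hr => ?_
  obtain ⟨a, ha, b, hb, hab⟩ := hdiam r hr
  obtain ⟨i, hia, hib, hi⟩ := ((hAB a ha).and ((hAB b hb).and
    ((hR.tendsto_norm (a - b)).eventually_const_lt hab))).exists
  exact ⟨R i a, hia, R i b, hib, by rwa [← map_sub]⟩

variable {l : Ultrafilter ι}

theorem exists_tendsto_apply (hR : IsAsymptoticRetraction (l : Filter ι) R) (f : StrongDual ℝ X)
    (y : Y) : ∃ a : ℝ, ‖a‖ ≤ ‖f‖ * ‖y‖ ∧ Tendsto (fun i => f (R i y)) l (𝓝 a) := by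
  have eventually_mem : ∀ᶠ i in (l : Filter ι), f (R i y) ∈ Metric.closedBall 0 (‖f‖ * ‖y‖) := by
    filter_upwards [hR.eventually_norm_le y] with i hi
    exact mem_closedBall_zero_iff.2 (f.le_opNorm_of_le hi)
  obtain ⟨a, ha, hla⟩ := (isCompact_closedBall (0 : ℝ) (‖f‖ * ‖y‖)).ultrafilter_le_nhds
    (l.map fun i => f (R i y)) (le_principal_iff.2 (mem_map.2 eventually_mem))
  exact ⟨a, mem_closedBall_zero_iff.1 ha, hla⟩

theorem exists_extension (hR : IsAsymptoticRetraction (l : Filter ι) R) (f : StrongDual ℝ X) :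
    ∃ g : StrongDual ℝ Y, ‖g‖ = ‖f‖ ∧ (∀ x : X, g x = f x) ∧
      ∀ y, Tendsto (fun i => f (R i y)) l (𝓝 (g y)) := by
  choose g hg hlim using hR.exists_tendsto_apply f
  let G : StrongDual ℝ Y := (linearMapOfTendsto (l := (l : Filter ι)) g
    (fun i => f.toLinearMap ∘ₗ R i) (tendsto_pi_nhds.2 hlim)).mkContinuous ‖f‖ hg
  have hGX (x : X) : G x = f x :=
    tendsto_nhds_unique (hlim x) ((f.continuous.tendsto x).comp (hR.tendsto_coe x))
  refine ⟨G, le_antisymm (LinearMap.mkContinuous_norm_le _ (norm_nonneg f) hg) ?_, hGX, hlim⟩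
  refine f.opNorm_le_bound (norm_nonneg G) fun x => ?_
  rw [← hGX x]
  exact G.le_opNorm x

end IsAsymptoticRetraction

theorem IsAIIdeal.exists_isAsymptoticRetraction_ultrafilter (hX : IsAIIdeal X) :
    ∃ (l : Ultrafilter (Finset Y × ℕ)) (R : Finset Y × ℕ → Y →ₗ[ℝ] X),
      IsAsymptoticRetraction (l : Filter (Finset Y × ℕ)) R := by
  classical
  obtain ⟨R, hR⟩ := hX.exists_isAsymptoticRetraction
  exact ⟨Ultrafilter.of atTop, R, hR.mono (Ultrafilter.of_le _)⟩

theorem LD2P.of_isAIIdeal (hY : LD2P Y) (hX : IsAIIdeal X) : LD2P X := by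
  obtain ⟨l, R, hR⟩ := hX.exists_isAsymptoticRetraction_ultrafilter
  intro f ε hf hε
  obtain ⟨g, hg, -, hlim⟩ := hR.exists_extension f
  exact hR.diam_eq_two (slice_subset_closedBall g ε) (slice_subset_closedBall f ε)
    (fun y hy => hR.eventually_mem_slice (hlim y) hy) (hY g ε (hg.trans hf) hε)

theorem SD2P.of_isAIIdeal (hY : SD2P Y) (hX : IsAIIdeal X) : SD2P X := by
  obtain ⟨l, R, hR⟩ := hX.exists_isAsymptoticRetraction_ultrafilter
  intro n c f ε hc hsum hf hε
  choose g hg _ hlim using fun i => hR.exists_extension (f i)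
  refine hR.diam_eq_two (sliceCombination_subset_closedBall g ε hc hsum)
    (sliceCombination_subset_closedBall f ε hc hsum) ?_
    (hY n c g ε hc hsum (fun i => (hg i).trans (hf i)) hε)
  rintro _ ⟨z, hz, rfl⟩
  filter_upwards [eventually_all.2 fun j => hR.eventually_mem_slice (hlim j (z j)) (hz j)]
    with i hi
  exact ⟨fun j => R i (z j), hi, by simp only [map_sum, map_smul]⟩

theorem D2P.of_isAIIdeal (hY : D2P Y) (hX : IsAIIdeal X) : D2P X := by
  obtain ⟨l, R, hR⟩ := hX.exists_isAsymptoticRetraction_ultrafilter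
  rintro V hV ⟨x₀, hx₀⟩
  have hVball := hV.subset_closedBall
  obtain ⟨U, hU, rfl⟩ := hV
  -- The weak topology is induced by evaluation at all functionals, so `U` is the preimage of an
  -- open `W`, and evaluation at their extensions gives a weakly open set of `Y`.
  obtain ⟨W, hW, rfl⟩ := isOpen_induced_iff.1 hU
  choose g _ hgX hlim using hR.exists_extension
  let U' : Set (WeakSpace ℝ Y) := {y | (fun f => g f ((toWeakSpace ℝ Y).symm y)) ∈ W}
  have hU' : IsOpen U' := hW.preimage <| continuous_pi fun f =>
    WeakBilin.eval_continuous (topDualPairing ℝ Y).flip (g f)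
  have hV' : IsRelWeaklyOpen (Metric.closedBall (0 : Y) 1 ∩ toWeakSpace ℝ Y ⁻¹' U') :=
    ⟨U', hU', rfl⟩
  have hx₀U' : (fun f => g f x₀) ∈ W := by
    simp only [hgX]
    exact hx₀.2
  refine hR.diam_eq_two hV'.subset_closedBall hVball ?_
    (hY _ hV' ⟨x₀, coe_mem_closedBall_iff.2 hx₀.1, hx₀U'⟩)
  rintro y ⟨hy, hyU'⟩
  have ht : Tendsto (fun i => fun f : StrongDual ℝ X => f (R i y)) l (𝓝 fun f => g f y) :=
    tendsto_pi_nhds.2 fun f => hlim f y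
  exact (hR.eventually_mem_closedBall hy).and (ht (hW.mem_nhds hyU'))

end AsymptoticRetraction

section SeparableIdeals

theorem exists_countable_superset_closed {α : Type*} {S : Finset α → Set α}
    (hS : ∀ t, (S t).Countable) {A : Set α} (hA : A.Countable) :
    ∃ D : Set α, D.Countable ∧ A ⊆ D ∧ ∀ t : Finset α, (t : Set α) ⊆ D → S t ⊆ D := by
  let step (B : Set α) : Set α := B ∪ ⋃ t ∈ {t : Finset α | (t : Set α) ⊆ B}, S t
  let D (n : ℕ) : Set α := step^[n] A
  have D_succ (n) : D (n + 1) = step (D n) := Function.iterate_succ_apply' _ _ _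
  have D_countable (n) : (D n).Countable := by
    induction n with
    | zero => exact hA
    | succ n ih =>
      rw [D_succ]
      have : {t : Finset α | (t : Set α) ⊆ D n}.Countable := by
        refine ((Set.countable_ofPred_finite_subset ih).preimage Finset.coe_injective).mono ?_
        intro t ht
        exact ⟨t.finite_toSet, ht⟩
      exact ih.union (this.biUnion fun t _ => hS t)
  have D_mono : Monotone D := monotone_nat_of_le_succ fun n => by
    rw [D_succ]
    exact Set.subset_union_left
  refine ⟨⋃ n, D n, Set.countable_iUnion D_countable, Set.subset_iUnion D 0, fun t ht => ?_⟩
  obtain ⟨n, hn⟩ := D_mono.directed_le.exists_mem_subset_of_finset_subset_biUnion ht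
  calc S t ⊆ step (D n) := (Set.subset_biUnion_of_mem (u := S) hn).trans Set.subset_union_right
    _ = D (n + 1) := (D_succ n).symm
    _ ⊆ ⋃ n, D n := Set.subset_iUnion D (n + 1)

theorem exists_finset_subset_le_span {K M : Type*} [DivisionRing K] [AddCommGroup M] [Module K M]
    {D : Set M} {F : Submodule K M} [FiniteDimensional K F] (hF : F ≤ Submodule.span K D) :
    ∃ t : Finset M, (t : Set M) ⊆ D ∧ F ≤ Submodule.span K (t : Set M) := by
  obtain ⟨s, rfl⟩ := (Submodule.fg_iff_finiteDimensional F).2 inferInstance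
  obtain ⟨t, htD, hst⟩ := Submodule.subset_span_finite_of_subset_span (Submodule.span_le.1 hF)
  exact ⟨t, htD, Submodule.span_le.2 hst⟩

theorem exists_countable_forall_norm_approx {ι W Y : Type*} [NormedAddCommGroup W]
    [NormedSpace ℝ W] [ProperSpace W] [SeminormedAddCommGroup Y] [NormedSpace ℝ Y]
    (T : ι → W →L[ℝ] Y) :
    ∃ J : Set ι, J.Countable ∧ ∀ i, ∀ η : ℝ, 0 < η →
      ∃ j ∈ J, ∀ w, |‖T j w‖ - ‖T i w‖| ≤ η * ‖w‖ := by
  have : CompactSpace (Metric.closedBall (0 : W) 1) :=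
    isCompact_iff_compactSpace.1 (isCompact_closedBall _ _)
  let Φ (i : ι) : C(Metric.closedBall (0 : W) 1, ℝ) := ⟨fun w => ‖T i w‖, by fun_prop⟩
  obtain ⟨t, ht, ht_dense⟩ := TopologicalSpace.exists_countable_dense (Set.range Φ)
  choose index hindex using fun x : Set.range Φ => x.2
  refine ⟨index '' t, ht.image index, fun i η hη => ?_⟩
  obtain ⟨x, hxt, hx⟩ := ht_dense.exists_dist_lt ⟨Φ i, i, rfl⟩ hη
  refine ⟨index x, ⟨x, hxt, rfl⟩, fun w => ?_⟩
  have hdist : dist (Φ (index x)) (Φ i) < η := by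
    rw [hindex x, dist_comm]
    exact hx
  have on_ball (v : W) (hv : ‖v‖ ≤ 1) : |‖T (index x) v‖ - ‖T i v‖| ≤ η :=
    (ContinuousMap.dist_apply_le_dist (f := Φ (index x)) (g := Φ i)
      ⟨v, mem_closedBall_zero_iff.2 hv⟩).trans hdist.le
  rcases eq_or_ne w 0 with rfl | hw
  · simp
  have hw_pos : 0 < ‖w‖ := norm_pos_iff.2 hw
  have := on_ball (‖w‖⁻¹ • w) (by rw [norm_smul, norm_inv, norm_norm, inv_mul_cancel₀ hw_pos.ne'])
  simpa only [map_smul, norm_smul, norm_inv, norm_norm, ← mul_sub, abs_mul, abs_inv, abs_norm,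
    inv_mul_le_iff₀ hw_pos, mul_comm ‖w‖ η] using this

variable {Y : Type*} [NormedAddCommGroup Y] [NormedSpace ℝ Y]

/-- The operator `(f, a) ↦ f + ∑ j, a j • y j` parametrizing the span of the subspace `F` and the
tuple `y`. The tuple may be dependent, so the operator need not be injective. -/
def addCombination {κ : Type*} [Fintype κ] (F : Submodule ℝ Y) (y : κ → Y) :
    F × (κ → ℝ) →L[ℝ] Y :=
  F.subtypeL.coprod (∑ j, (ContinuousLinearMap.proj j).smulRight (y j))

theorem addCombination_apply {κ : Type*} [Fintype κ] (F : Submodule ℝ Y) (y : κ → Y)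
    (p : F × (κ → ℝ)) : addCombination F y p = p.1 + ∑ j, p.2 j • y j := by
  simp [addCombination]

theorem exists_addCombination_rightInverse {E F : Submodule ℝ Y} [FiniteDimensional ℝ E]
    (hFE : F ≤ E) :
    ∃ (k : ℕ) (e : Fin k → Y) (L : Y →L[ℝ] F × (Fin k → ℝ)),
      (∀ f : F, L f = (f, 0)) ∧ ∀ y ∈ E, addCombination F e (L y) = y := by
  have : FiniteDimensional ℝ F := Submodule.finiteDimensional_of_le hFE
  obtain ⟨P, hP⟩ := Submodule.ClosedComplemented.of_finiteDimensional F
  obtain ⟨Q, hQ⟩ := Submodule.ClosedComplemented.of_finiteDimensional E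
  let β := Module.finBasis ℝ E
  let coords : Y →L[ℝ] Fin (Module.finrank ℝ E) → ℝ :=
    β.equivFunL.toContinuousLinearMap.comp (Q.comp (.id ℝ Y - F.subtypeL.comp P))
  refine ⟨_, fun j => β j, P.prod coords, fun f => ?_, fun y hy => ?_⟩
  · simp [coords, hP]
  · have hmem : y - P y ∈ E := E.sub_mem hy (hFE (P y).2)
    have hsum : ∑ j, coords y j • (β j : Y) = y - P y := by
      have hsum_E := congrArg E.subtype (β.sum_equivFun (Q (y - P y)))
      simp only [map_sum, map_smul, Submodule.subtype_apply] at hsum_E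
      exact hsum_E.trans (congrArg Subtype.val (hQ ⟨_, hmem⟩))
    rw [addCombination_apply]
    exact (congrArg (_ + ·) hsum).trans (add_sub_cancel _ _)

theorem exists_countable_forall_almostIsometry (F : Submodule ℝ Y) [FiniteDimensional ℝ F] :
    ∃ S : Set Y, S.Countable ∧ ∀ E : Submodule ℝ Y, FiniteDimensional ℝ E → F ≤ E →
      ∀ ε : ℝ, 0 < ε → ∃ T : Y →ₗ[ℝ] Y, (∀ y, T y ∈ F ⊔ Submodule.span ℝ S) ∧
        (∀ y ∈ F, T y = y) ∧ ∀ y ∈ E, |‖T y‖ - ‖y‖| ≤ ε * ‖y‖ := by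
  choose J hJ happrox using fun k : ℕ =>
    exists_countable_forall_norm_approx (addCombination F : (Fin k → Y) → _)
  refine ⟨⋃ (k) (z ∈ J k), Set.range z, Set.countable_iUnion fun k =>
    (hJ k).biUnion fun z _ => Set.countable_range z, fun E _ hFE ε hε => ?_⟩
  obtain ⟨k, e, L, hLF, hLE⟩ := exists_addCombination_rightInverse hFE
  obtain ⟨z, hz, hze⟩ := happrox k e (ε / (‖L‖ + 1)) (by positivity)
  refine ⟨((addCombination F z).comp L).toLinearMap, fun y => ?_, fun y hy => ?_, fun y hy => ?_⟩
  · refine (addCombination_apply F z (L y)).symm ▸ Submodule.add_mem_sup (L y).1.2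
      (Submodule.sum_mem _ fun j _ => Submodule.smul_mem _ _ (Submodule.subset_span ?_))
    simp only [Set.mem_iUnion]
    exact ⟨k, z, hz, j, rfl⟩
  · have : L y = (⟨y, hy⟩, 0) := hLF ⟨y, hy⟩
    simp [addCombination_apply, this]
  · calc |‖addCombination F z (L y)‖ - ‖y‖|
        = |‖addCombination F z (L y)‖ - ‖addCombination F e (L y)‖| := by rw [hLE y hy]
      _ ≤ ε / (‖L‖ + 1) * ‖L y‖ := hze (L y)
      _ ≤ ε / (‖L‖ + 1) * ((‖L‖ + 1) * ‖y‖) := by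
        gcongr
        exact L.le_of_opNorm_le (le_add_of_nonneg_right zero_le_one) y
      _ = ε * ‖y‖ := by field_simp

theorem exists_countable_superset_isAIIdeal_span {A : Set Y} (hA : A.Countable) :
    ∃ D : Set Y, D.Countable ∧ A ⊆ D ∧ IsAIIdeal (Submodule.span ℝ D) := by
  choose S hS hT using fun t : Finset Y =>
    exists_countable_forall_almostIsometry (Submodule.span ℝ (t : Set Y))
  obtain ⟨D, hD, hAD, hclosed⟩ := exists_countable_superset_closed hS hA
  refine ⟨D, hD, hAD, isAIIdeal_iff_exists_linearMap.2 fun ε hε E _ => ?_⟩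
  obtain ⟨t, htD, ht⟩ := exists_finset_subset_le_span
    (inf_le_right : E ⊓ Submodule.span ℝ D ≤ Submodule.span ℝ D)
  obtain ⟨T, hTmem, hTfix, hTnorm⟩ :=
    hT t (E ⊔ Submodule.span ℝ (t : Set Y)) inferInstance le_sup_right ε hε
  have hle : Submodule.span ℝ (t : Set Y) ⊔ Submodule.span ℝ (S t) ≤ Submodule.span ℝ D :=
    sup_le (Submodule.span_mono htD) (Submodule.span_mono (hclosed t htD))
  refine ⟨T.codRestrict _ fun y => hle (hTmem y), fun x hx => ?_, fun y hy => ?_⟩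
  · exact Subtype.ext (hTfix x (ht ⟨hx, x.2⟩))
  · exact hTnorm y (Submodule.mem_sup_left hy)

theorem exists_perturbation_mem {V F : Submodule ℝ Y} [FiniteDimensional ℝ F]
    (hF : F ≤ V.topologicalClosure) {δ : ℝ} (hδ : 0 < δ) :
    ∃ N : Y →L[ℝ] Y, ‖N‖ ≤ δ ∧ (∀ y, N y ∈ V.topologicalClosure) ∧ ∀ y ∈ F, y + N y ∈ V := by
  obtain ⟨P, hP⟩ := Submodule.ClosedComplemented.of_finiteDimensional F
  let β := Module.finBasis ℝ F
  obtain ⟨C, hC, hbound⟩ := β.exists_opNorm_le (F := Y)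
  let η : ℝ := δ / (C * (‖P‖ + 1))
  have hη : 0 < η := by positivity
  choose b hbV hbη using fun i => Metric.mem_closure_iff.1 (hF (β i).2) η hη
  let u : F →L[ℝ] Y := LinearMap.toContinuousLinearMap (β.constr ℝ fun i => b i - β i)
  have u_basis (i) : u (β i) = b i - β i := β.constr_basis ℝ _ i
  have u_norm : ‖u‖ ≤ C * η := hbound hη.le fun i => by
    rw [u_basis, ← dist_eq_norm, dist_comm]
    exact (hbη i).le
  have u_mem (x : F) : u x ∈ V.topologicalClosure := by
    suffices ⊤ ≤ V.topologicalClosure.comap u.toLinearMap from this trivial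
    rw [← β.span_eq, Submodule.span_le, Set.range_subset_iff]
    intro i
    change u (β i) ∈ V.topologicalClosure
    rw [u_basis]
    exact sub_mem (V.le_topologicalClosure (hbV i)) (hF (β i).2)
  have add_u_mem (x : F) : (x : Y) + u x ∈ V := by
    suffices ⊤ ≤ V.comap (F.subtype + u.toLinearMap) from this trivial
    rw [← β.span_eq, Submodule.span_le, Set.range_subset_iff]
    intro i
    simpa [u_basis] using hbV i
  refine ⟨u.comp P, ?_, fun y => u_mem _, fun y hy => ?_⟩
  · calc ‖u.comp P‖ ≤ ‖u‖ * ‖P‖ := u.opNorm_comp_le P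
      _ ≤ C * η * (‖P‖ + 1) := by gcongr; linarith
      _ = δ := by simp only [η]; field_simp
  · simpa [hP ⟨y, hy⟩] using add_u_mem ⟨y, hy⟩

theorem IsAIIdeal.topologicalClosure {V : Submodule ℝ Y} (hV : IsAIIdeal V) :
    IsAIIdeal V.topologicalClosure := by
  refine isAIIdeal_iff_exists_linearMap.2 fun ε hε E _ => ?_
  obtain ⟨δ, hδ, hδ_one, hδε⟩ : ∃ δ : ℝ, 0 < δ ∧ δ ≤ 1 ∧ 4 * δ ≤ ε :=
    ⟨min 1 (ε / 4), by positivity, min_le_left _ _, by linarith [min_le_right 1 (ε / 4)]⟩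
  obtain ⟨N, hN, hNmem, hNV⟩ :=
    exists_perturbation_mem (inf_le_right : E ⊓ V.topologicalClosure ≤ _) hδ
  let s : Y →ₗ[ℝ] Y := .id + N.toLinearMap
  obtain ⟨T, hTfix, hTnorm⟩ :=
    isAIIdeal_iff_exists_linearMap.1 hV δ hδ (E.map s) inferInstance
  -- `T ∘ s` is `s` on `E ∩ closure V`, so subtracting `N = s - id` restores the identity there.
  refine ⟨(V.subtype ∘ₗ T ∘ₗ s - N.toLinearMap).codRestrict _ fun y =>
    sub_mem (V.le_topologicalClosure (T (s y)).2) (hNmem y), fun x hx => ?_, fun y hy => ?_⟩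
  · have hsx : s x ∈ V := hNV x ⟨hx, x.2⟩
    have hTx : (T (s x) : Y) = s x :=
      congrArg Subtype.val (hTfix ⟨s x, hsx⟩ (Submodule.mem_map_of_mem hx))
    exact Subtype.ext ((congrArg (· - N x) hTx).trans (add_sub_cancel_right _ _))
  · change |‖(T (s y) : Y) - N y‖ - ‖y‖| ≤ ε * ‖y‖
    have hNy : ‖N y‖ ≤ δ * ‖y‖ := N.le_of_opNorm_le hN y
    have hsy : |‖s y‖ - ‖y‖| ≤ ‖N y‖ := by
      simpa [s] using abs_norm_sub_norm_le (s y) y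
    have hTy : |‖(T (s y) : Y) - N y‖ - ‖T (s y)‖| ≤ ‖N y‖ := by
      simpa using abs_norm_sub_norm_le ((T (s y) : Y) - N y) (T (s y))
    have hTs := hTnorm (s y) (Submodule.mem_map_of_mem hy)
    have hs_le : δ * ‖s y‖ ≤ δ * (2 * ‖y‖) := by
      gcongr
      linarith [(abs_le.1 hsy).2, mul_le_of_le_one_left (norm_nonneg y) hδ_one]
    have hε_le : 4 * δ * ‖y‖ ≤ ε * ‖y‖ := by gcongr
    rw [abs_le] at hsy hTy hTs ⊢
    constructor <;> linarith

theorem exists_separable_isAIIdeal {A : Set Y} (hA : A.Countable) :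
    ∃ X : Submodule ℝ Y, IsClosed (X : Set Y) ∧ TopologicalSpace.SeparableSpace X ∧
      IsAIIdeal X ∧ A ⊆ X := by
  obtain ⟨D, hD, hAD, hDX⟩ := exists_countable_superset_isAIIdeal_span hA
  refine ⟨(Submodule.span ℝ D).topologicalClosure, Submodule.isClosed_topologicalClosure _,
    (hD.isSeparable.span (R := ℝ)).closure.separableSpace, hDX.topologicalClosure, ?_⟩
  exact hAD.trans (Submodule.subset_span.trans (Submodule.le_topologicalClosure _))

theorem exists_countable_forall_norm_comp_subtypeL_eq {𝕜 E G : Type*} [RCLike 𝕜]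
    [NormedAddCommGroup E] [NormedSpace 𝕜 E] [SeminormedAddCommGroup G] [NormedSpace 𝕜 G]
    (f : E →L[𝕜] G) :
    ∃ A : Set E, A.Countable ∧
      ∀ X : Submodule 𝕜 E, A ⊆ X → ‖f.comp X.subtypeL‖ = ‖f‖ := by
  obtain ⟨u, -, hu, hlim⟩ := exists_seq_strictMono_tendsto ‖f‖
  choose y hy huy using fun n => f.exists_lt_apply_of_lt_opNorm (hu n)
  refine ⟨Set.range y, Set.countable_range y, fun X hX => le_antisymm ?_ ?_⟩
  · exact (f.comp X.subtypeL).opNorm_le_bound (norm_nonneg f) fun x => f.le_opNorm x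
  · refine le_of_tendsto' hlim fun n => (huy n).le.trans ?_
    exact (f.comp X.subtypeL).unit_le_opNorm ⟨y n, hX ⟨n, rfl⟩⟩ (hy n).le

theorem exists_separable_isAIIdeal_norm_comp_subtypeL {κ : Type*} [Countable κ]
    (f : κ → StrongDual ℝ Y) :
    ∃ X : Submodule ℝ Y, IsClosed (X : Set Y) ∧ TopologicalSpace.SeparableSpace X ∧
      IsAIIdeal X ∧ ∀ i, ‖(f i).comp X.subtypeL‖ = ‖f i‖ := by
  choose A hA hnorm using fun i => exists_countable_forall_norm_comp_subtypeL_eq (f i)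
  obtain ⟨X, hXclosed, hXsep, hX, hAX⟩ := exists_separable_isAIIdeal (Set.countable_iUnion hA)
  exact ⟨X, hXclosed, hXsep, hX, fun i => hnorm i X ((Set.subset_iUnion A i).trans hAX)⟩

theorem LD2P.of_forall_separable (h : ∀ X : Submodule ℝ Y, IsClosed (X : Set Y) →
    TopologicalSpace.SeparableSpace X → IsAIIdeal X → LD2P X) : LD2P Y := by
  intro f ε hf hε
  obtain ⟨X, hXclosed, hXsep, hX, hnorm⟩ :=
    exists_separable_isAIIdeal_norm_comp_subtypeL fun _ : Unit => f
  exact diam_eq_two_of_coe_mem (slice_subset_closedBall f ε) (fun x hx => coe_mem_slice_iff.2 hx)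
    (h X hXclosed hXsep hX (f.comp X.subtypeL) ε ((hnorm ()).trans hf) hε)

theorem SD2P.of_forall_separable (h : ∀ X : Submodule ℝ Y, IsClosed (X : Set Y) →
    TopologicalSpace.SeparableSpace X → IsAIIdeal X → SD2P X) : SD2P Y := by
  intro n c f ε hc hsum hf hε
  obtain ⟨X, hXclosed, hXsep, hX, hnorm⟩ := exists_separable_isAIIdeal_norm_comp_subtypeL f
  exact diam_eq_two_of_coe_mem (sliceCombination_subset_closedBall f ε hc hsum)
    (fun x hx => coe_mem_sliceCombination hx)
    (h X hXclosed hXsep hX n c _ ε hc hsum (fun i => (hnorm i).trans (hf i)) hε)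

theorem D2P.of_forall_separable (h : ∀ X : Submodule ℝ Y, IsClosed (X : Set Y) →
    TopologicalSpace.SeparableSpace X → IsAIIdeal X → D2P X) : D2P Y := by
  rintro V hV ⟨y, hy⟩
  obtain ⟨X, hXclosed, hXsep, hX, hyX⟩ := exists_separable_isAIIdeal (Set.countable_singleton y)
  exact diam_eq_two_of_coe_mem hV.subset_closedBall (fun x hx => hx)
    (h X hXclosed hXsep hX _ hV.preimage_coe ⟨⟨y, hyX rfl⟩, hy⟩)

end SeparableIdeals

end DiamTwo

theorem mainTheorem2_general {Y : Type*} [NormedAddCommGroup Y] [NormedSpace ℝ Y] :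
    (DiamTwo.SD2P Y ↔
      ∀ X : Submodule ℝ Y, IsClosed (X : Set Y) → TopologicalSpace.SeparableSpace X →
        DiamTwo.IsAIIdeal X → DiamTwo.SD2P X) ∧
    (DiamTwo.D2P Y ↔
      ∀ X : Submodule ℝ Y, IsClosed (X : Set Y) → TopologicalSpace.SeparableSpace X →
        DiamTwo.IsAIIdeal X → DiamTwo.D2P X) ∧
    (DiamTwo.LD2P Y ↔
      ∀ X : Submodule ℝ Y, IsClosed (X : Set Y) → TopologicalSpace.SeparableSpace X →
        DiamTwo.IsAIIdeal X → DiamTwo.LD2P X) :=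
  ⟨⟨fun h _ _ _ hX => h.of_isAIIdeal hX, DiamTwo.SD2P.of_forall_separable⟩,
    ⟨fun h _ _ _ hX => h.of_isAIIdeal hX, DiamTwo.D2P.of_forall_separable⟩,
    ⟨fun h _ _ _ hX => h.of_isAIIdeal hX, DiamTwo.LD2P.of_forall_separable⟩⟩

theorem mainTheorem2 {Y : Type*} [NormedAddCommGroup Y] [NormedSpace ℝ Y] [CompleteSpace Y] :
    (DiamTwo.SD2P Y ↔
      ∀ X : Submodule ℝ Y, IsClosed (X : Set Y) → TopologicalSpace.SeparableSpace X →
        DiamTwo.IsAIIdeal X → DiamTwo.SD2P X) ∧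
    (DiamTwo.D2P Y ↔
      ∀ X : Submodule ℝ Y, IsClosed (X : Set Y) → TopologicalSpace.SeparableSpace X →
        DiamTwo.IsAIIdeal X → DiamTwo.D2P X) ∧
    (DiamTwo.LD2P Y ↔
      ∀ X : Submodule ℝ Y, IsClosed (X : Set Y) → TopologicalSpace.SeparableSpace X →
        DiamTwo.IsAIIdeal X → DiamTwo.LD2P X) :=
  mainTheorem2_general
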